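/- Let $n>p\ge 1$ be integers. A data set is a real $n\times p$ matrix $X$ with entries $|x_{ij}|\le 1$; two data sets $X,X'$ are neighbours if they differ in at most one row and $\|X-X'\|\le 1$, where $\|X\|=(\sum_{i,j}x_{ij}^2)^{1/2}$. Let $A$ be uniformly distributed (Haar probability measure) on the group of orthogonal $n\times n$ matrices, and let $C$ be an $n\times p$ matrix, independent of $A$, with independent $N(0,\sigma^2)$ entries. Consider the two release mechanisms (B) $Y(X)=A(X+C)$, and (C) $Y(X)=AX+C$. For $\varepsilon,\delta>0$, say that a mechanism satisfies the density-set condition for $(\varepsilon,\delta)$ if, for every data set $X$, $Y(X)$ has a density $p_{Y(X)}$ with respect to Lebesgue measure on $\mathbb{R}^{n\times p}$ and, for all neighbouring data sets $X,X'$, $$P\big[Y(X)\in\{y: p_{Y(X)}(y)>e^{\varepsilon}p_{Y(X')}(y)\}\big]\le\delta .$$ **Corollary.** Let $0<\varepsilon<1$ and $0<\delta<1$. If $$\sigma\ \ge\ \sqrt{\frac{2np+3\ln(1/\delta)}{n-p}}\ \frac{\sqrt{4p}}{\sqrt{\varepsilon}},$$ then both mechanisms (B) and (C) satisfy the density-set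 condition for $(\varepsilon,\delta)$. In particular, noise variance of order $1/\varepsilon$ suffices when $\ln(1/\delta)$ is at most of the order of $n/p$: for every $p\ge1$ and $K>0$ there is a constant $M>0$, depending only on $p$ and $K$, such that for all $n>p$, all $0<\varepsilon<1$ and all $0<\delta<1$ with $\ln(1/\delta)\le K\,n/p$, every $\sigma>0$ with $\sigma^2\ge M/\varepsilon$ makes both mechanisms (B) and (C) satisfy the density-set condition for $(\varepsilon,\delta)$. -/

import Mathlib

open MeasureTheory ProbabilityTheory

noncomputable section

namespace MatrixMasking

/-- Real `n × p` matrices (data sets, noise matrices and releases). -/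
abbrev DataMatrix (n p : ℕ) : Type := Matrix (Fin n) (Fin p) ℝ

/-- The product (equivalently, Borel) σ-algebra on real matrices. -/
instance instMeasurableSpaceDataMatrix (n p : ℕ) : MeasurableSpace (DataMatrix n p) :=
  inferInstanceAs (MeasurableSpace (Fin n → Fin p → ℝ))

instance instBorelSpaceDataMatrix (n p : ℕ) : BorelSpace (DataMatrix n p) :=
  inferInstanceAs (BorelSpace (Fin n → Fin p → ℝ))

/-- Lebesgue measure on real `n × p` matrices, identified with `ℝ^(n p)` through the entries. -/
instance instMeasureSpaceDataMatrix (n p : ℕ) : MeasureSpace (DataMatrix n p) where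
  volume := (volume : Measure (Fin n → Fin p → ℝ))

/-- The group of real orthogonal `n × n` matrices. -/
abbrev OrthGroup (n : ℕ) : Type := Matrix.orthogonalGroup (Fin n) ℝ

instance instCompactSpaceOrthGroup (n : ℕ) : CompactSpace (OrthGroup n) := by
  have hcl : IsClosed (Matrix.orthogonalGroup (Fin n) ℝ : Set (Matrix (Fin n) (Fin n) ℝ)) :=
    isClosed_unitary
  have hK : IsCompact (Set.univ.pi fun _ : Fin n => Set.univ.pi fun _ : Fin n =>
      Set.Icc (-1 : ℝ) 1) :=
    isCompact_univ_pi fun _ => isCompact_univ_pi fun _ => isCompact_Icc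
  refine isCompact_iff_compactSpace.mp (hK.of_isClosed_subset hcl ?_)
  intro U hU i _ j _
  exact abs_le.mp (entry_norm_bound_of_unitary (𝕜 := ℝ) hU i j)

/-- The uniform distribution on the orthogonal group: the Haar probability measure. -/
def orthUniform (n : ℕ) : Measure (OrthGroup n) :=
  Measure.haarMeasure (⊤ : TopologicalSpace.PositiveCompacts (OrthGroup n))

/-- The law of an `n × p` matrix with independent `N(0, σ²)` entries. -/
def gaussianNoise (n p : ℕ) (σ : ℝ) : Measure (DataMatrix n p) :=
  (Measure.pi fun _ : Fin n => Measure.pi fun _ : Fin p => gaussianReal 0 (σ ^ 2).toNNReal :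
    Measure (Fin n → Fin p → ℝ))

/-- Noise first, then masking: the law of `Y(X) = A (X + C)`, with `A` uniform on the orthogonal
group and `C` an independent Gaussian noise matrix. -/
def settingB (n p : ℕ) (σ : ℝ) (X : DataMatrix n p) : Measure (DataMatrix n p) :=
  ((orthUniform n).prod (gaussianNoise n p σ)).map
    fun w => (w.1 : Matrix (Fin n) (Fin n) ℝ) * (X + w.2)

/-- Masking first, then noise: the law of `Y(X) = A X + C`, with `A` uniform on the orthogonal
group and `C` an independent Gaussian noise matrix. -/
def settingC (n p : ℕ) (σ : ℝ) (X : DataMatrix n p) : Measure (DataMatrix n p) :=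
  ((orthUniform n).prod (gaussianNoise n p σ)).map
    fun w => (w.1 : Matrix (Fin n) (Fin n) ℝ) * X + w.2

/-- Admissible raw data: all entries are at most one in absolute value. -/
def Bounded {n p : ℕ} (X : DataMatrix n p) : Prop :=
  ∀ i j, |X i j| ≤ 1

/-- Neighbouring data sets: they differ in (at most) one row, and the Euclidean (`L₂`) norm of the
difference is at most one. -/
def Neighbors {n p : ℕ} (X X' : DataMatrix n p) : Prop :=
  Real.sqrt (∑ i, ∑ j, (X i j - X' i j) ^ 2) ≤ 1 ∧
    ∃ i, ∀ k, k ≠ i → ∀ j, X k j = X' k j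

/-- The set `{y : f(y) > e^ε g(y)}`, with `f`, `g` the Lebesgue densities of the laws `μ`, `ν`. -/
def densityRatioSet {n p : ℕ} (ε : ℝ) (μ ν : Measure (DataMatrix n p)) : Set (DataMatrix n p) :=
  {y | μ.rnDeriv volume y > ENNReal.ofReal (Real.exp ε) * ν.rnDeriv volume y}

/-- The density-set condition for the mechanism `X ↦ Y(X)`, given by the law `Y X` of the release:
every release is a random matrix with a Lebesgue density, and
`P[Y(X) ∈ {y : p_{Y(X)}(y) > e^ε p_{Y(X')}(y)}] ≤ δ` for all neighbouring data sets `X`, `X'`. -/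
def DensitySetCondition {n p : ℕ} (ε δ : ℝ) (Y : DataMatrix n p → Measure (DataMatrix n p)) :
    Prop :=
  (∀ X, Bounded X → IsProbabilityMeasure (Y X) ∧ Y X ≪ volume) ∧
    ∀ X X', Bounded X → Bounded X' → Neighbors X X' →
      Y X (densityRatioSet ε (Y X) (Y X')) ≤ ENNReal.ofReal δ

end MatrixMasking

end

/-!
The two mechanisms have the same law, since Gaussian noise is invariant under orthogonal maps
(`settingB_eq_settingC`), so only `A X + C` has to be studied. Its density at `y` is a Gaussian factor
in `‖y‖² + ‖X‖²` times the average of `exp (⟨y, A X⟩ / σ²)` over the orthogonal group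
(`releaseDensity_eq`).

Let `X` and `X'` differ in row `i` only, let `Z` be `X` with that row set to zero, and let `e` be the
`i`-th basis vector, so that `X = Z + e xᵀ` with `x` the row. The vector `e` is orthogonal to the
columns of `Z`. By invariance of Haar measure and reflections fixing `Z`, the average for `Z + e xᵀ` is
unchanged if `e` is replaced by any other unit vector orthogonal to the columns of `Z`. Averaging over
`±e` gives a hyperbolic cosine, hence a lower bound by the average for `Z`
(`orthExpAvg_le_add_vecMulVec`). Averaging over the sign patterns of `(n - p)^(-1/2) ∑ ± vⱼ`, with
`vⱼ` orthonormal in the complement of the columns of `Z`, and using `cosh t ≤ exp (t² / 2)` together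
with Bessel's inequality gives an upper bound which is larger only by a sub-Gaussian factor with
variance proxy `1 / (n - p)` (`orthExpAvg_add_vecMulVec_le`). Thus the log-ratio of the two densities at
`y` is at most `p ‖y‖² / (2 (n - p) σ⁴) + p / (2 σ²)` (`releaseDensity_le`), which is of order `1 / σ²`
because `‖y‖²` is of order `n p σ²`; this is why a noise variance of order `1 / ε` suffices. The last step
is a Chernoff bound for `‖C‖²` (`gaussianNoise_tail`).
-/

noncomputable section

namespace MatrixMasking


/-! ### Instances and invariance of the Haar measure -/

instance instSecondCountableDataMatrix (n p : ℕ) : SecondCountableTopology (DataMatrix n p) :=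
  inferInstanceAs (SecondCountableTopology (Fin n → Fin p → ℝ))

instance instSecondCountableOrthGroup (n : ℕ) : SecondCountableTopology (OrthGroup n) :=
  TopologicalSpace.Subtype.secondCountableTopology _

instance instIsAddHaarMeasureDataMatrix (n p : ℕ) :
    (volume : Measure (DataMatrix n p)).IsAddHaarMeasure :=
  Measure.pi.isAddHaarMeasure fun _ : Fin n => (volume : Measure (Fin p → ℝ))

instance instSigmaFiniteDataMatrix (n p : ℕ) : SigmaFinite (volume : Measure (DataMatrix n p)) :=
  inferInstanceAs (SigmaFinite (volume : Measure (Fin n → Fin p → ℝ)))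

instance instIsProbabilityMeasureGaussianNoise (n p : ℕ) (σ : ℝ) :
    IsProbabilityMeasure (gaussianNoise n p σ) :=
  inferInstanceAs (IsProbabilityMeasure (Measure.pi fun _ : Fin n =>
    Measure.pi fun _ : Fin p => gaussianReal 0 (σ ^ 2).toNNReal))

instance instIsHaarMeasureOrthUniform (n : ℕ) : (orthUniform n).IsHaarMeasure :=
  inferInstanceAs (Measure.haarMeasure _).IsHaarMeasure

instance instIsProbabilityMeasureOrthUniform (n : ℕ) : IsProbabilityMeasure (orthUniform n) :=
  ⟨by simpa [orthUniform] using Measure.haarMeasure_self (G := OrthGroup n) (K₀ := ⊤)⟩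

/-- Compact groups are unimodular: a right translate of the Haar probability measure is again a
left-invariant probability measure. -/
instance instIsMulRightInvariantOrthUniform (n : ℕ) : (orthUniform n).IsMulRightInvariant := by
  refine ⟨fun g => ?_⟩
  have : IsProbabilityMeasure ((orthUniform n).map (· * g)) :=
    Measure.isProbabilityMeasure_map (by fun_prop)
  have : ((orthUniform n).map (· * g)).IsHaarMeasure :=
    Measure.isHaarMeasure_of_isCompact_nonempty_interior _ Set.univ isCompact_univ
      (by simp) (by simp) (by simp)
  exact Measure.isHaarMeasure_eq_of_isProbabilityMeasure _ _

/-! ### Products of densities -/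

lemma lintegral_pi_prod {n : ℕ} {E : Type*} [MeasurableSpace E] (μ : Fin n → Measure E)
    [∀ i, SigmaFinite (μ i)] (f : Fin n → E → ENNReal) (hf : ∀ i, Measurable (f i)) :
    ∫⁻ x, ∏ i, f i (x i) ∂(Measure.pi μ) = ∏ i, ∫⁻ x, f i x ∂(μ i) := by
  induction n with
  | zero => simp
  | succ n ih =>
    rw [← ((measurePreserving_piFinSuccAbove μ 0).symm).lintegral_comp_emb
      (MeasurableEquiv.measurableEmbedding _)]
    simp_rw [MeasurableEquiv.piFinSuccAbove_symm_apply, Fin.insertNthEquiv,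
      Fin.prod_univ_succ, Fin.insertNth_zero, Equiv.coe_fn_mk, Fin.cons_succ,
      Fin.zero_succAbove, Fin.cons_zero, cast_eq]
    have hm : Measurable fun x : Fin n → E => ∏ i : Fin n, f i.succ (x i) :=
      Finset.measurable_prod _ fun i _ => (hf i.succ).comp (measurable_pi_apply i)
    rw [lintegral_prod_mul (hf 0).aemeasurable hm.aemeasurable,
      ih _ _ fun i => hf _]

lemma pi_withDensity {n : ℕ} {E : Type*} [MeasurableSpace E] (μ : Measure E) [SigmaFinite μ]
    (f : E → ENNReal) (hf : Measurable f) [SigmaFinite (μ.withDensity f)] :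
    Measure.pi (fun _ : Fin n => μ.withDensity f) =
      (Measure.pi fun _ : Fin n => μ).withDensity fun x => ∏ i, f (x i) := by
  refine Measure.pi_eq fun s hs => ?_
  rw [withDensity_apply _ (.univ_pi hs), Measure.restrict_pi_pi,
    lintegral_pi_prod _ _ fun _ => hf]
  simp_rw [withDensity_apply _ (hs _)]


/-! ### Linear algebra: reflections and orthonormal systems -/

section LinearAlgebra

open Matrix

/-- Orthogonal maps fixing the columns of `Z` act transitively on the unit vectors orthogonal to
them. -/
lemma exists_orth_fix {n p : ℕ} (Z : DataMatrix n p) (a b : Fin n → ℝ) (ha : a ⬝ᵥ a = 1)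
    (hb : b ⬝ᵥ b = 1) (hZa : a ᵥ* Z = 0) (hZb : b ᵥ* Z = 0) :
    ∃ B : OrthGroup n, (B : Matrix (Fin n) (Fin n) ℝ) *ᵥ a = b ∧
      (B : Matrix (Fin n) (Fin n) ℝ) * Z = Z := by
  by_cases hab : a = b
  · exact ⟨1, by simp [hab]⟩
  -- The Householder reflection exchanging `a` and `b`.
  set u := a - b with hu
  have hu0 : u ⬝ᵥ u ≠ 0 := fun h => hab (sub_eq_zero.1 (dotProduct_self_eq_zero.1 h))
  have huu : u ⬝ᵥ u = 2 * (u ⬝ᵥ a) := by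
    simp only [hu, sub_dotProduct, dotProduct_sub, ha, hb, dotProduct_comm b a]; ring
  have huZ : u ᵥ* Z = 0 := by rw [hu, sub_vecMul, hZa, hZb, sub_zero]
  have hua : u ⬝ᵥ a ≠ 0 := fun h => hu0 (by rw [huu, h, mul_zero])
  refine ⟨⟨1 - (2 / (u ⬝ᵥ u)) • vecMulVec u u, ?_⟩, ?_, ?_⟩
  · rw [mem_orthogonalGroup_iff]
    simp only [transpose_sub, transpose_one, transpose_smul, transpose_vecMulVec, mul_sub, sub_mul,
      mul_one, one_mul, smul_mul_assoc, mul_smul_comm, vecMulVec_mul_vecMulVec, smul_smul,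
      vecMulVec_smul]
    rw [div_mul_cancel₀ _ hu0]
    module
  · have : (2 / (u ⬝ᵥ u)) * (u ⬝ᵥ a) = 1 := by rw [huu]; field_simp
    rw [sub_mulVec, one_mulVec, smul_mulVec, vecMulVec_mulVec, op_smul_eq_smul, smul_smul,
      this, one_smul]
    exact sub_sub_cancel a b
  · rw [Matrix.sub_mul, Matrix.one_mul, Matrix.smul_mul, vecMulVec_mul, huZ]
    ext i j
    simp [vecMulVec_apply]

/-- The orthogonal complement of the columns of `Z` contains `n - p` orthonormal vectors; the last
clause is Bessel's inequality for them. -/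
lemma exists_orthonormal_vecMul_eq_zero {n p : ℕ} (Z : DataMatrix n p) :
    ∃ v : Fin (n - p) → Fin n → ℝ, (∀ i j, v i ⬝ᵥ v j = if i = j then 1 else 0) ∧
      (∀ j, v j ᵥ* Z = 0) ∧ ∀ w : Fin n → ℝ, ∑ j, (v j ⬝ᵥ w) ^ 2 ≤ w ⬝ᵥ w := by
  let K : Submodule ℝ (EuclideanSpace ℝ (Fin n)) :=
    Submodule.span ℝ (Set.range fun j : Fin p => WithLp.toLp 2 (Z.col j))
  have hK : Module.finrank ℝ K ≤ p := (finrank_range_le_card _).trans (by simp)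
  have hd : n - p ≤ Module.finrank ℝ Kᗮ := by
    have h := K.finrank_add_finrank_orthogonal
    rw [finrank_euclideanSpace_fin] at h
    omega
  let b := stdOrthonormalBasis ℝ Kᗮ
  let v : Fin (n - p) → EuclideanSpace ℝ (Fin n) := fun j => (b (Fin.castLE hd j) : _)
  have hv : Orthonormal ℝ v :=
    (b.orthonormal.comp_linearIsometry Kᗮ.subtypeₗᵢ).comp _ (Fin.castLE_injective hd)
  have hin (x y : EuclideanSpace ℝ (Fin n)) : inner ℝ x y = (x : Fin n → ℝ) ⬝ᵥ (y : Fin n → ℝ) := by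
    rw [EuclideanSpace.inner_eq_star_dotProduct, star_trivial, dotProduct_comm]
  refine ⟨fun j => v j, fun i j => ?_, fun j => ?_, fun w => ?_⟩
  · rw [← hin, orthonormal_iff_ite.1 hv i j]
  · ext k
    have h := (b (Fin.castLE hd j)).2 _ (Submodule.subset_span ⟨k, rfl⟩)
    rw [hin, dotProduct_comm] at h
    exact h
  · have h := hv.sum_inner_products_le (WithLp.toLp 2 w) (s := Finset.univ)
    rw [← real_inner_self_eq_norm_sq, hin] at h
    simpa only [hin, Real.norm_eq_abs, sq_abs] using h

/-- The Frobenius inner product of real matrices. -/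
def frobInner {n p : ℕ} (y W : DataMatrix n p) : ℝ := (yᵀ * W).trace

lemma frobInner_eq_sum {n p : ℕ} (y W : DataMatrix n p) :
    frobInner y W = ∑ i, ∑ j, y i j * W i j := by
  rw [Finset.sum_comm]
  simp [frobInner, trace, Matrix.mul_apply]

lemma frobInner_comm {n p : ℕ} (y W : DataMatrix n p) : frobInner y W = frobInner W y := by
  simp only [frobInner_eq_sum, mul_comm]

lemma frobInner_self_nonneg {n p : ℕ} (W : DataMatrix n p) : 0 ≤ frobInner W W := by
  rw [frobInner_eq_sum]
  exact Finset.sum_nonneg fun i _ => Finset.sum_nonneg fun j _ => mul_self_nonneg _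

lemma frobInner_smul_right {n p : ℕ} (c : ℝ) (y W : DataMatrix n p) :
    frobInner y (c • W) = c * frobInner y W := by
  simp [frobInner]

lemma frobInner_sub_self {n p : ℕ} (y W : DataMatrix n p) :
    frobInner (y - W) (y - W) = frobInner y y - 2 * frobInner y W + frobInner W W := by
  have h := frobInner_comm W y
  simp only [frobInner, transpose_sub, Matrix.sub_mul, Matrix.mul_sub, trace_sub] at h ⊢
  linarith

lemma frobInner_orth_mul {n p : ℕ} (A : OrthGroup n) (y W : DataMatrix n p) :
    frobInner ((A : Matrix (Fin n) (Fin n) ℝ) * y) ((A : Matrix (Fin n) (Fin n) ℝ) * W) =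
      frobInner y W := by
  have hA : (A : Matrix (Fin n) (Fin n) ℝ)ᵀ * A = 1 := (mem_orthogonalGroup_iff' _ _).1 A.2
  rw [frobInner, transpose_mul, Matrix.mul_assoc, ← Matrix.mul_assoc _ _ W, hA, Matrix.one_mul,
    frobInner]

lemma frobInner_mul_add_vecMulVec {n p : ℕ} (A : Matrix (Fin n) (Fin n) ℝ) (y Z : DataMatrix n p)
    (a : Fin n → ℝ) (x : Fin p → ℝ) :
    frobInner y (A * (Z + vecMulVec a x)) = frobInner y (A * Z) + a ⬝ᵥ (Aᵀ *ᵥ (y *ᵥ x)) := by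
  have : frobInner y (A * vecMulVec a x) = a ⬝ᵥ (Aᵀ *ᵥ (y *ᵥ x)) := by
    rw [frobInner, mul_vecMulVec, mul_vecMulVec, trace_vecMulVec, mulVec_transpose,
      ← dotProduct_mulVec, mulVec_transpose]
    rw [dotProduct_comm a, ← dotProduct_mulVec, dotProduct_comm]
  rw [← this, Matrix.mul_add]
  simp [frobInner, Matrix.mul_add]

lemma mulVec_dotProduct_self_le {n p : ℕ} (y : DataMatrix n p) (x : Fin p → ℝ) :
    (y *ᵥ x) ⬝ᵥ (y *ᵥ x) ≤ frobInner y y * (x ⬝ᵥ x) := by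
  rw [frobInner_eq_sum, Finset.sum_mul]
  refine Finset.sum_le_sum fun i _ => ?_
  have := Finset.sum_mul_sq_le_sq_mul_sq Finset.univ (y i) x
  simpa only [mulVec, dotProduct, ← sq] using this

lemma orth_transpose_mulVec_dotProduct_self {n : ℕ} (A : OrthGroup n) (w : Fin n → ℝ) :
    ((A : Matrix (Fin n) (Fin n) ℝ)ᵀ *ᵥ w) ⬝ᵥ ((A : Matrix (Fin n) (Fin n) ℝ)ᵀ *ᵥ w) = w ⬝ᵥ w := by
  have hA : (A : Matrix (Fin n) (Fin n) ℝ) * (A : Matrix (Fin n) (Fin n) ℝ)ᵀ = 1 :=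
    (mem_orthogonalGroup_iff _ _).1 A.2
  rw [dotProduct_mulVec, vecMul_transpose, mulVec_mulVec, hA, one_mulVec]

end LinearAlgebra

/-! ### Exponential averages over the orthogonal group -/

section Average

open Matrix

/-- The sign `±1` encoded by a Boolean. -/
def boolSign (b : Bool) : ℝ := bif b then 1 else -1

lemma boolSign_mul_self (b : Bool) : boolSign b * boolSign b = 1 := by
  cases b <;> simp [boolSign]

/-- A Rademacher sum is sub-Gaussian. -/
lemma sum_exp_boolSign_le {m : ℕ} (c : Fin m → ℝ) :
    ∑ s : Fin m → Bool, Real.exp (∑ j, boolSign (s j) * c j) ≤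
      2 ^ m * Real.exp ((∑ j, c j ^ 2) / 2) := by
  have h : ∑ s : Fin m → Bool, Real.exp (∑ j, boolSign (s j) * c j) =
      ∏ j, (2 * Real.cosh (c j)) := by
    simp_rw [Real.exp_sum]
    rw [← Fintype.piFinset_univ,
      ← Finset.prod_univ_sum (fun _ => Finset.univ) fun j b => Real.exp (boolSign b * c j)]
    refine Finset.prod_congr rfl fun j _ => ?_
    simp [boolSign, Real.cosh_eq]
    ring
  rw [h, Finset.prod_mul_distrib, Finset.prod_const, Finset.card_univ, Fintype.card_fin,
    Finset.sum_div, Real.exp_sum]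
  gcongr with j
  exact Real.cosh_le_exp_half_sq _

/-- The exponential average `W ↦ E exp ⟨y, A W⟩`, with `A` uniform on the orthogonal group. -/
def orthExpAvg {n p : ℕ} (y W : DataMatrix n p) : ENNReal :=
  ∫⁻ A, ENNReal.ofReal (Real.exp (frobInner y ((A : Matrix (Fin n) (Fin n) ℝ) * W)))
    ∂(orthUniform n)

lemma measurable_exp_frobInner {n p : ℕ} (y W : DataMatrix n p) :
    Measurable fun A : OrthGroup n =>
      ENNReal.ofReal (Real.exp (frobInner y ((A : Matrix (Fin n) (Fin n) ℝ) * W))) := by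
  refine (Continuous.measurable ?_).ennreal_ofReal
  unfold frobInner
  fun_prop

lemma orthExpAvg_mul {n p : ℕ} (y W : DataMatrix n p) (B : OrthGroup n) :
    orthExpAvg y ((B : Matrix (Fin n) (Fin n) ℝ) * W) = orthExpAvg y W := by
  unfold orthExpAvg
  conv_rhs => rw [← lintegral_mul_right_eq_self _ B]
  simp [Matrix.mul_assoc]

lemma orthExpAvg_add_vecMulVec_congr {n p : ℕ} (y Z : DataMatrix n p) (x : Fin p → ℝ)
    {a b : Fin n → ℝ} (ha : a ⬝ᵥ a = 1) (hb : b ⬝ᵥ b = 1) (hZa : a ᵥ* Z = 0) (hZb : b ᵥ* Z = 0) :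
    orthExpAvg y (Z + vecMulVec a x) = orthExpAvg y (Z + vecMulVec b x) := by
  obtain ⟨B, hBa, hBZ⟩ := exists_orth_fix Z a b ha hb hZa hZb
  rw [← orthExpAvg_mul y _ B, Matrix.mul_add, hBZ, mul_vecMulVec, hBa]

/-- Adding a rank-one term in a direction orthogonal to the columns cannot decrease the exponential
average, since the average over the two signs of that direction is a hyperbolic cosine. -/
lemma orthExpAvg_le_add_vecMulVec {n p : ℕ} (y Z : DataMatrix n p) (x : Fin p → ℝ)
    {a : Fin n → ℝ} (ha : a ⬝ᵥ a = 1) (hZa : a ᵥ* Z = 0) :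
    orthExpAvg y Z ≤ orthExpAvg y (Z + vecMulVec a x) := by
  have hneg : orthExpAvg y (Z + vecMulVec a x) = orthExpAvg y (Z + vecMulVec (-a) x) :=
    orthExpAvg_add_vecMulVec_congr y Z x ha (by simpa using ha) hZa (by simp [neg_vecMul, hZa])
  have h2 : 2 * orthExpAvg y Z ≤ 2 * orthExpAvg y (Z + vecMulVec a x) := by
    conv_rhs => rw [two_mul]
    nth_rewrite 2 [hneg]
    unfold orthExpAvg
    rw [← lintegral_add_left (measurable_exp_frobInner y _),
      ← lintegral_const_mul _ (measurable_exp_frobInner y _)]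
    refine lintegral_mono fun A => ?_
    simp only [frobInner_mul_add_vecMulVec, neg_dotProduct, Real.exp_add]
    set t := a ⬝ᵥ ((A : Matrix (Fin n) (Fin n) ℝ)ᵀ *ᵥ (y *ᵥ x))
    rw [← ENNReal.ofReal_add (by positivity) (by positivity), ← ENNReal.ofReal_ofNat,
      ← ENNReal.ofReal_mul (by positivity)]
    refine ENNReal.ofReal_le_ofReal ?_
    have := Real.one_le_cosh t
    rw [Real.cosh_eq] at this
    nlinarith [Real.exp_pos (frobInner y ((A : Matrix (Fin n) (Fin n) ℝ) * Z))]
  exact (ENNReal.mul_le_mul_iff_right (by simp) (by simp)).1 h2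

/-- Adding a rank-one term in a unit direction orthogonal to the columns of `Z` increases the
exponential average by at most a sub-Gaussian factor of variance proxy `1 / (n - p)`: the direction
may be replaced by a normalized Rademacher sum of `n - p` orthonormal vectors. -/
lemma orthExpAvg_add_vecMulVec_le {n p : ℕ} (hpn : p < n) (y Z : DataMatrix n p) (x : Fin p → ℝ)
    {a : Fin n → ℝ} (ha : a ⬝ᵥ a = 1) (hZa : a ᵥ* Z = 0) :
    orthExpAvg y (Z + vecMulVec a x) ≤
      ENNReal.ofReal (Real.exp (frobInner y y * (x ⬝ᵥ x) / (2 * ((n : ℝ) - p)))) *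
        orthExpAvg y Z := by
  obtain ⟨m, hm⟩ : ∃ m, m = n - p := ⟨_, rfl⟩
  have hex := exists_orthonormal_vecMul_eq_zero Z
  rw [← hm] at hex
  obtain ⟨v, hv, hvZ, hvw⟩ := hex
  have hmR : ((n : ℝ) - p) = m := by rw [hm, Nat.cast_sub hpn.le]
  have hm0 : (0 : ℝ) < m := by rw [← hmR]; exact sub_pos.2 (by exact_mod_cast hpn)
  set r : ℝ := (√(m : ℝ))⁻¹ with hr
  have hr2 : r * r = 1 / m := by
    rw [hr, ← mul_inv, Real.mul_self_sqrt hm0.le, one_div]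
  let z : (Fin m → Bool) → Fin n → ℝ := fun s => ∑ j, (r * boolSign (s j)) • v j
  have hz1 (s) : z s ⬝ᵥ z s = 1 := by
    have hj (j : Fin m) : r * boolSign (s j) * (r * boolSign (s j)) = 1 / m := by
      rw [mul_mul_mul_comm, boolSign_mul_self, hr2, mul_one]
    simp only [z, sum_dotProduct, dotProduct_sum, smul_dotProduct, dotProduct_smul, hv, smul_eq_mul,
      mul_ite, mul_one, mul_zero, Finset.sum_ite_eq', Finset.mem_univ, if_true,
      hj, Finset.sum_const, Finset.card_univ, Fintype.card_fin, nsmul_eq_mul]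
    field_simp
  have hzZ (s) : z s ᵥ* Z = 0 := by
    simp [z, sum_vecMul, smul_vecMul, hvZ]
  -- Sum over all `2 ^ m` sign patterns: each of them gives the same exponential average.
  have key : (2 : ENNReal) ^ m * orthExpAvg y (Z + vecMulVec a x) ≤
      2 ^ m * (ENNReal.ofReal (Real.exp (frobInner y y * (x ⬝ᵥ x) / (2 * ((n : ℝ) - p)))) *
        orthExpAvg y Z) := by
    have h1 : (2 : ENNReal) ^ m * orthExpAvg y (Z + vecMulVec a x) =
        ∑ s : Fin m → Bool, orthExpAvg y (Z + vecMulVec (z s) x) := by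
      rw [Finset.sum_congr rfl fun s _ =>
        (orthExpAvg_add_vecMulVec_congr y Z x ha (hz1 s) hZa (hzZ s)).symm]
      simp
    rw [h1]
    unfold orthExpAvg
    rw [← lintegral_finsetSum _ fun s _ => measurable_exp_frobInner y _, ← mul_assoc,
      ← lintegral_const_mul _ (measurable_exp_frobInner y _)]
    refine lintegral_mono fun A => ?_
    simp only [frobInner_mul_add_vecMulVec, Real.exp_add]
    set w := (A : Matrix (Fin n) (Fin n) ℝ)ᵀ *ᵥ (y *ᵥ x) with hw
    have hzw (s) : z s ⬝ᵥ w = ∑ j, boolSign (s j) * (r * (v j ⬝ᵥ w)) := by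
      simp only [z, sum_dotProduct, smul_dotProduct, smul_eq_mul]
      exact Finset.sum_congr rfl fun j _ => by ring
    have hexp : (∑ j, (r * (v j ⬝ᵥ w)) ^ 2) / 2 ≤
        frobInner y y * (x ⬝ᵥ x) / (2 * ((n : ℝ) - p)) := by
      have hww : w ⬝ᵥ w ≤ frobInner y y * (x ⬝ᵥ x) := by
        rw [hw, orth_transpose_mulVec_dotProduct_self]
        exact mulVec_dotProduct_self_le y x
      have h2 := (hvw w).trans hww
      simp_rw [mul_pow, ← Finset.mul_sum, sq r, hr2]
      rw [hmR, div_mul_eq_mul_div, one_mul, div_div, mul_comm (m : ℝ)]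
      gcongr
    rw [← ENNReal.ofReal_sum_of_nonneg fun s _ => by positivity,
      ← ENNReal.ofReal_ofNat 2, ← ENNReal.ofReal_pow (by norm_num),
      ← ENNReal.ofReal_mul (by positivity), ← ENNReal.ofReal_mul (by positivity)]
    refine ENNReal.ofReal_le_ofReal ?_
    rw [← Finset.mul_sum, mul_comm]
    refine mul_le_mul_of_nonneg_right ?_ (Real.exp_pos _).le
    simp_rw [hzw]
    refine (sum_exp_boolSign_le _).trans ?_
    gcongr
  exact (ENNReal.mul_le_mul_iff_right (by simp) (by simp)).1 key

end Average


/-! ### Gaussian noise: density, rotation invariance, tail -/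

/-- The Lebesgue density of the law of an `n × p` matrix with independent `N(0, σ²)` entries. -/
def noiseDensity {n p : ℕ} (σ : ℝ) (c : DataMatrix n p) : ENNReal :=
  ENNReal.ofReal
    ((√(2 * Real.pi * σ ^ 2))⁻¹ ^ (n * p) * Real.exp (-frobInner c c / (2 * σ ^ 2)))

lemma measurable_noiseDensity {n p : ℕ} (σ : ℝ) :
    Measurable (noiseDensity σ : DataMatrix n p → ENNReal) := by
  refine (Continuous.measurable ?_).ennreal_ofReal
  unfold frobInner
  fun_prop

lemma prod_prod_ofReal {n p : ℕ} (g : Fin n → Fin p → ℝ) (hg : ∀ i j, 0 ≤ g i j) :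
    ∏ i, ∏ j, ENNReal.ofReal (g i j) = ENNReal.ofReal (∏ i, ∏ j, g i j) := by
  rw [ENNReal.ofReal_prod_of_nonneg fun i _ => Finset.prod_nonneg fun j _ => hg i j]
  exact Finset.prod_congr rfl fun i _ => (ENNReal.ofReal_prod_of_nonneg fun j _ => hg i j).symm

lemma coe_toNNReal_sq (σ : ℝ) : ((σ ^ 2).toNNReal : ℝ) = σ ^ 2 := Real.coe_toNNReal _ (sq_nonneg σ)

lemma toNNReal_sq_ne_zero {σ : ℝ} (hσ : 0 < σ) : (σ ^ 2).toNNReal ≠ 0 :=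
  (Real.toNNReal_pos.2 (by positivity)).ne'

lemma gaussianNoise_eq_withDensity (n p : ℕ) {σ : ℝ} (hσ : 0 < σ) :
    gaussianNoise n p σ = volume.withDensity (noiseDensity σ) := by
  have hv := toNNReal_sq_ne_zero hσ
  have hpdf := measurable_gaussianPDF 0 (σ ^ 2).toNNReal
  have : SigmaFinite ((volume : Measure ℝ).withDensity (gaussianPDF 0 (σ ^ 2).toNNReal)) := by
    rw [← gaussianReal_of_var_ne_zero 0 hv]; infer_instance
  have h1 := pi_withDensity (n := p) (volume : Measure ℝ) _ hpdf
  have : SigmaFinite ((Measure.pi fun _ : Fin p => (volume : Measure ℝ)).withDensity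
      fun x => ∏ j, gaussianPDF 0 (σ ^ 2).toNNReal (x j)) := by
    rw [← h1]; infer_instance
  have h2 := pi_withDensity (n := n) (Measure.pi fun _ : Fin p => (volume : Measure ℝ))
    (fun x => ∏ j, gaussianPDF 0 (σ ^ 2).toNNReal (x j))
    (Finset.measurable_prod _ fun j _ => hpdf.comp (measurable_pi_apply j))
  have h3 : (noiseDensity σ : DataMatrix n p → ENNReal) =
      fun c => ∏ i, ∏ j, gaussianPDF 0 (σ ^ 2).toNNReal (c i j) := by
    funext c
    refine Eq.trans ?_ (prod_prod_ofReal (fun i j => gaussianPDFReal 0 (σ ^ 2).toNNReal (c i j))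
      fun _ _ => gaussianPDFReal_nonneg _ _ _).symm
    simp only [noiseDensity, gaussianPDFReal, coe_toNNReal_sq, sub_zero, Finset.prod_mul_distrib,
      Finset.prod_const, Finset.card_univ, Fintype.card_fin, ← Real.exp_sum, frobInner_eq_sum]
    rw [← pow_mul, mul_comm p n]
    congr 3
    simp_rw [← Finset.sum_div, Finset.sum_neg_distrib, sq]
  rw [h3, gaussianNoise]
  simp_rw [gaussianReal_of_var_ne_zero 0 hv, h1]
  exact h2

instance instLocallyCompactSpaceDataMatrix (n p : ℕ) : LocallyCompactSpace (DataMatrix n p) :=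
  inferInstanceAs (LocallyCompactSpace (Fin n → Fin p → ℝ))

/-- Gaussian noise is invariant under left multiplication by an orthogonal matrix `A`. Its density
is, and Lebesgue measure is multiplied by a constant, which equals `1` because the Gaussian law has
mass `1` before and after. -/
lemma map_orth_mul_gaussianNoise {n p : ℕ} {σ : ℝ} (hσ : 0 < σ) (A : OrthGroup n) :
    (gaussianNoise n p σ).map (fun c => (A : Matrix (Fin n) (Fin n) ℝ) * c) =
      gaussianNoise n p σ := by
  have hA : (A : Matrix (Fin n) (Fin n) ℝ).transpose * A = 1 :=
    (Matrix.mem_orthogonalGroup_iff' _ _).1 A.2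
  have hA' : (A : Matrix (Fin n) (Fin n) ℝ) * (A : Matrix (Fin n) (Fin n) ℝ).transpose = 1 :=
    (Matrix.mem_orthogonalGroup_iff _ _).1 A.2
  let e : DataMatrix n p ≃+ DataMatrix n p :=
    { toFun := fun c => (A : Matrix (Fin n) (Fin n) ℝ) * c
      invFun := fun c => (A : Matrix (Fin n) (Fin n) ℝ).transpose * c
      left_inv := fun c => by simp only [← Matrix.mul_assoc, hA, Matrix.one_mul]
      right_inv := fun c => by simp only [← Matrix.mul_assoc, hA', Matrix.one_mul]
      map_add' := fun c d => Matrix.mul_add _ _ _ }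
  have he : Continuous e := continuous_const.matrix_mul continuous_id
  have he' : Continuous e.symm := continuous_const.matrix_mul continuous_id
  have hhaar : ((volume : Measure (DataMatrix n p)).map e).IsAddHaarMeasure :=
    e.isAddHaarMeasure_map _ he he'
  obtain ⟨k, hk⟩ : ∃ k : ENNReal, (volume : Measure (DataMatrix n p)).map e = k • volume :=
    ⟨_, Measure.isAddLeftInvariant_eq_smul _ _⟩
  have hinv (c : DataMatrix n p) : noiseDensity σ (e c) = noiseDensity σ c := by
    change noiseDensity σ ((A : Matrix (Fin n) (Fin n) ℝ) * c) = _
    rw [noiseDensity, frobInner_orth_mul, noiseDensity]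
  have hmap : (gaussianNoise n p σ).map e = k • gaussianNoise n p σ := by
    rw [gaussianNoise_eq_withDensity n p hσ, ← withDensity_smul_measure, ← hk]
    ext s hs
    rw [Measure.map_apply he.measurable hs, withDensity_apply _ (he.measurable hs),
      withDensity_apply _ hs, setLIntegral_map hs (measurable_noiseDensity σ) he.measurable]
    simp_rw [hinv]
  have hk1 : k = 1 := by
    have h := congrArg (fun μ : Measure (DataMatrix n p) => μ Set.univ) hmap
    simp only [Measure.map_apply he.measurable MeasurableSet.univ, Set.preimage_univ, measure_univ,
      Measure.smul_apply, smul_eq_mul, mul_one] at h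
    exact h.symm
  rw [hk1, one_smul] at hmap
  exact hmap

lemma lintegral_exp_sq_gaussianReal {σ : ℝ} (hσ : 0 < σ) :
    ∫⁻ x, ENNReal.ofReal (Real.exp (x ^ 2 / (4 * σ ^ 2))) ∂(gaussianReal 0 (σ ^ 2).toNNReal) =
      ENNReal.ofReal √2 := by
  have hv := toNNReal_sq_ne_zero hσ
  rw [gaussianReal_of_var_ne_zero 0 hv,
    lintegral_withDensity_eq_lintegral_mul _ (measurable_gaussianPDF _ _) (by fun_prop)]
  -- The tilted density is `√2` times the density of a centred Gaussian of twice the variance.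
  have h (x : ℝ) : (gaussianPDF 0 (σ ^ 2).toNNReal *
      fun x => ENNReal.ofReal (Real.exp (x ^ 2 / (4 * σ ^ 2)))) x =
      ENNReal.ofReal √2 * ENNReal.ofReal (gaussianPDFReal 0 (2 * (σ ^ 2).toNNReal) x) := by
    rw [Pi.mul_apply, gaussianPDF, ← ENNReal.ofReal_mul (gaussianPDFReal_nonneg _ _ _),
      ← ENNReal.ofReal_mul (by positivity)]
    congr 1
    simp only [gaussianPDFReal, NNReal.coe_mul, NNReal.coe_ofNat, coe_toNNReal_sq, sub_zero]
    rw [mul_assoc, ← Real.exp_add,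
      show 2 * Real.pi * (2 * σ ^ 2) = 2 * (2 * Real.pi * σ ^ 2) by ring,
      Real.sqrt_mul zero_le_two, mul_inv, ← mul_assoc, ← mul_assoc,
      mul_inv_cancel₀ (by positivity), one_mul]
    congr 2
    field_simp
    ring
  simp_rw [h]
  rw [lintegral_const_mul _ (by fun_prop), lintegral_gaussianPDFReal_eq_one 0 (by simpa using hv),
    mul_one]

lemma lintegral_exp_frobInner_gaussianNoise (n p : ℕ) {σ : ℝ} (hσ : 0 < σ) :
    ∫⁻ c, ENNReal.ofReal (Real.exp (frobInner c c / (4 * σ ^ 2))) ∂(gaussianNoise n p σ) =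
      ENNReal.ofReal √2 ^ (n * p) := by
  have h (c : DataMatrix n p) : ENNReal.ofReal (Real.exp (frobInner c c / (4 * σ ^ 2))) =
      ∏ i, ∏ j, ENNReal.ofReal (Real.exp (c i j ^ 2 / (4 * σ ^ 2))) := by
    rw [prod_prod_ofReal _ fun _ _ => (Real.exp_pos _).le]
    simp only [← Real.exp_sum, frobInner_eq_sum, Finset.sum_div, sq]
  simp_rw [h]
  rw [gaussianNoise]
  refine (lintegral_pi_prod (n := n) (E := Fin p → ℝ) _
    (fun _ x => ∏ j, ENNReal.ofReal (Real.exp (x j ^ 2 / (4 * σ ^ 2)))) fun _ => ?_).trans ?_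
  · fun_prop
  · have h2 := lintegral_pi_prod (n := p) (fun _ => gaussianReal 0 (σ ^ 2).toNNReal)
      (fun _ x => ENNReal.ofReal (Real.exp (x ^ 2 / (4 * σ ^ 2)))) fun _ => by fun_prop
    simp only [h2, lintegral_exp_sq_gaussianReal hσ, Finset.prod_const, Finset.card_univ,
      Fintype.card_fin]
    rw [← pow_mul, mul_comm p n]

/-- Chernoff bound for the squared Frobenius norm of Gaussian noise. -/
lemma gaussianNoise_tail (n p : ℕ) {σ : ℝ} (hσ : 0 < σ) (L : ℝ) :
    gaussianNoise n p σ {c | σ ^ 2 * (2 * ((n : ℝ) * p) + 4 * L) ≤ frobInner c c} ≤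
      ENNReal.ofReal (Real.exp (-L)) := by
  -- Markov's inequality for `exp (‖c‖² / (4σ²))`, of mean `√2 ^ (np) ≤ exp (np / 2)`.
  set T : ℝ := ((n : ℝ) * p) / 2 + L with hT
  have hmeas : Measurable fun c : DataMatrix n p =>
      ENNReal.ofReal (Real.exp (frobInner c c / (4 * σ ^ 2))) := by
    refine (Continuous.measurable ?_).ennreal_ofReal
    unfold frobInner
    fun_prop
  have hmarkov := mul_meas_ge_le_lintegral (μ := gaussianNoise n p σ) hmeas
    (ENNReal.ofReal (Real.exp T))
  rw [lintegral_exp_frobInner_gaussianNoise n p hσ] at hmarkov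
  have hsub : {c : DataMatrix n p | σ ^ 2 * (2 * ((n : ℝ) * p) + 4 * L) ≤ frobInner c c} ⊆
      {c | ENNReal.ofReal (Real.exp T) ≤
        ENNReal.ofReal (Real.exp (frobInner c c / (4 * σ ^ 2)))} := by
    intro c hc
    refine ENNReal.ofReal_le_ofReal (Real.exp_le_exp.2 ?_)
    rw [le_div_iff₀ (by positivity), hT]
    have hc' : σ ^ 2 * (2 * ((n : ℝ) * p) + 4 * L) ≤ frobInner c c := hc
    linarith
  have hsqrt : (√2 : ℝ) ^ (n * p) ≤ Real.exp ((n : ℝ) * p / 2) := by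
    have h1 : (√2 : ℝ) ≤ Real.exp (1 / 2) := by
      refine (Real.sqrt_le_iff.2 ⟨by norm_num, by norm_num⟩ : (√2 : ℝ) ≤ 3 / 2).trans ?_
      linarith [Real.add_one_le_exp (1 / 2 : ℝ)]
    calc (√2 : ℝ) ^ (n * p) ≤ Real.exp (1 / 2) ^ (n * p) := by gcongr
      _ = Real.exp ((n : ℝ) * p / 2) := by
        rw [← Real.exp_nat_mul]; push_cast; ring_nf
  have hfin : ENNReal.ofReal (Real.exp T) *
      gaussianNoise n p σ {c | σ ^ 2 * (2 * ((n : ℝ) * p) + 4 * L) ≤ frobInner c c} ≤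
      ENNReal.ofReal (Real.exp T) * ENNReal.ofReal (Real.exp (-L)) := by
    refine (mul_le_mul_right (measure_mono hsub) _).trans (hmarkov.trans ?_)
    rw [← ENNReal.ofReal_pow (by positivity), ← ENNReal.ofReal_mul (by positivity),
      ← Real.exp_add, hT, add_neg_cancel_right]
    exact ENNReal.ofReal_le_ofReal hsqrt
  exact (ENNReal.mul_le_mul_iff_right (by simp [Real.exp_pos]) (by simp)).1 hfin


/-! ### The density of a release -/

/-- The Lebesgue density of the release `A X + C`. -/
def releaseDensity {n p : ℕ} (σ : ℝ) (X y : DataMatrix n p) : ENNReal :=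
  ∫⁻ A, noiseDensity σ (y - (A : Matrix (Fin n) (Fin n) ℝ) * X) ∂(orthUniform n)

lemma measurable_noiseDensity_sub_orth_mul {n p : ℕ} (σ : ℝ) (X : DataMatrix n p) :
    Measurable fun w : OrthGroup n × DataMatrix n p =>
      noiseDensity σ (w.2 - (w.1 : Matrix (Fin n) (Fin n) ℝ) * X) := by
  refine (measurable_noiseDensity σ).comp (Continuous.measurable ?_)
  fun_prop

lemma measurable_releaseDensity {n p : ℕ} (σ : ℝ) (X : DataMatrix n p) :
    Measurable (releaseDensity σ X) :=
  (measurable_noiseDensity_sub_orth_mul σ X).lintegral_prod_left'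

lemma measurable_orth_mul_add {n p : ℕ} (X : DataMatrix n p) :
    Measurable fun w : OrthGroup n × DataMatrix n p =>
      (w.1 : Matrix (Fin n) (Fin n) ℝ) * X + w.2 :=
  Continuous.measurable (by fun_prop)

lemma settingC_eq_withDensity {n p : ℕ} {σ : ℝ} (hσ : 0 < σ) (X : DataMatrix n p) :
    settingC n p σ X = volume.withDensity (releaseDensity σ X) := by
  ext s hs
  have hm := measurable_orth_mul_add X
  rw [settingC, Measure.map_apply hm hs, Measure.prod_apply (hm hs), withDensity_apply _ hs]
  have h (A : OrthGroup n) : gaussianNoise n p σ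
      (Prod.mk A ⁻¹' ((fun w : OrthGroup n × DataMatrix n p =>
        (w.1 : Matrix (Fin n) (Fin n) ℝ) * X + w.2) ⁻¹' s)) =
      ∫⁻ y in s, noiseDensity σ (y - (A : Matrix (Fin n) (Fin n) ℝ) * X) := by
    have hmA : MeasurableSet (Prod.mk A ⁻¹' ((fun w : OrthGroup n × DataMatrix n p =>
        (w.1 : Matrix (Fin n) (Fin n) ℝ) * X + w.2) ⁻¹' s)) := measurable_prodMk_left (hm hs)
    rw [gaussianNoise_eq_withDensity n p hσ, withDensity_apply _ hmA,
      ← lintegral_indicator hmA, ← lintegral_indicator hs]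
    conv_rhs => rw [← lintegral_add_left_eq_self _ ((A : Matrix (Fin n) (Fin n) ℝ) * X)]
    refine lintegral_congr fun c => ?_
    by_cases hc : (A : Matrix (Fin n) (Fin n) ℝ) * X + c ∈ s
    · rw [Set.indicator_of_mem hc]
      refine (Set.indicator_of_mem ?_ _).trans (by rw [add_sub_cancel_left])
      exact hc
    · rw [Set.indicator_of_notMem hc]
      refine Set.indicator_of_notMem ?_ _
      exact hc
  simp_rw [h]
  exact lintegral_lintegral_swap (measurable_noiseDensity_sub_orth_mul σ X).aemeasurable

/-- Both mechanisms have the same law, by rotation invariance of the noise. -/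
lemma settingB_eq_settingC {n p : ℕ} {σ : ℝ} (hσ : 0 < σ) :
    settingB n p σ = settingC n p σ := by
  funext X
  have hmul : Measurable fun w : OrthGroup n × DataMatrix n p =>
      (w.1 : Matrix (Fin n) (Fin n) ℝ) * w.2 := Continuous.measurable (by fun_prop)
  have hΦ : MeasurePreserving
      (fun w : OrthGroup n × DataMatrix n p => (w.1, (w.1 : Matrix (Fin n) (Fin n) ℝ) * w.2))
      ((orthUniform n).prod (gaussianNoise n p σ)) ((orthUniform n).prod (gaussianNoise n p σ)) :=
    (MeasurePreserving.id _).skew_product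
      (g := fun (A : OrthGroup n) c => (A : Matrix (Fin n) (Fin n) ℝ) * c) hmul
      (ae_of_all _ fun A => map_orth_mul_gaussianNoise hσ A)
  rw [settingB, settingC]
  conv_rhs => rw [← hΦ.map_eq, Measure.map_map (measurable_orth_mul_add X) hΦ.measurable]
  simp only [Matrix.mul_add, Function.comp_def]

/-- Expanding the square in the Gaussian exponent isolates the dependence on `A`, because
`‖A X‖ = ‖X‖`. -/
lemma releaseDensity_eq {n p : ℕ} {σ : ℝ} (hσ : 0 < σ) (X y : DataMatrix n p) :
    releaseDensity σ X y =
      ENNReal.ofReal ((√(2 * Real.pi * σ ^ 2))⁻¹ ^ (n * p) *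
        Real.exp (-(frobInner y y + frobInner X X) / (2 * σ ^ 2))) *
        orthExpAvg y ((σ ^ 2)⁻¹ • X) := by
  rw [releaseDensity, orthExpAvg, ← lintegral_const_mul _ (measurable_exp_frobInner y _)]
  refine lintegral_congr fun A => ?_
  rw [noiseDensity, ← ENNReal.ofReal_mul (by positivity),
    mul_assoc _ (Real.exp _) (Real.exp _), ← Real.exp_add, frobInner_sub_self, frobInner_orth_mul, Matrix.mul_smul, frobInner_smul_right]
  congr 3
  field_simp
  ring

lemma frobInner_self_le_of_bounded {n p : ℕ} {X : DataMatrix n p} (hX : Bounded X) :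
    frobInner X X ≤ (n : ℝ) * p := by
  rw [frobInner_eq_sum]
  calc ∑ i, ∑ j, X i j * X i j ≤ ∑ _i : Fin n, ∑ _j : Fin p, (1 : ℝ) := by
        gcongr with i _ j _
        have := (sq_le_one_iff_abs_le_one _).2 (hX i j)
        rwa [sq] at this
    _ = (n : ℝ) * p := by simp

lemma row_dotProduct_self_le_of_bounded {n p : ℕ} {X : DataMatrix n p} (hX : Bounded X)
    (i : Fin n) : X i ⬝ᵥ X i ≤ (p : ℝ) := by
  calc ∑ j, X i j * X i j ≤ ∑ _j : Fin p, (1 : ℝ) := by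
        gcongr with j _
        have := (sq_le_one_iff_abs_le_one _).2 (hX i j)
        rwa [sq] at this
    _ = (p : ℝ) := by simp

/-- The densities of two releases differ by a factor whose logarithm is of order
`‖y‖² / ((n - p) σ⁴)`. Both data sets are compared with the data set whose differing row is replaced
by zero. -/
lemma releaseDensity_le {n p : ℕ} (hpn : p < n) {σ : ℝ} (hσ : 0 < σ) {X X' : DataMatrix n p}
    (hX : Bounded X) (hX' : Bounded X') {i : Fin n} (hi : ∀ k, k ≠ i → ∀ j, X k j = X' k j)
    (y : DataMatrix n p) :
    releaseDensity σ X y ≤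
      ENNReal.ofReal (Real.exp
        (p * frobInner y y / (2 * ((n : ℝ) - p) * σ ^ 4) + p / (2 * σ ^ 2))) *
        releaseDensity σ X' y := by
  have hm : (0 : ℝ) < (n : ℝ) - p := sub_pos.2 (by exact_mod_cast hpn)
  -- `Z` is the common part of the two data sets; it is orthogonal to the basis vector `e`.
  let Z : DataMatrix n p := (σ ^ 2)⁻¹ • Matrix.updateRow X i 0
  let e : Fin n → ℝ := Pi.single i 1
  have he : e ⬝ᵥ e = 1 := by simp [e]
  have heZ : Matrix.vecMul e Z = 0 := by
    ext j
    simp [e, Z]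
  have hXZ : (σ ^ 2)⁻¹ • X = Z + Matrix.vecMulVec e ((σ ^ 2)⁻¹ • X i) := by
    ext k j
    by_cases hk : k = i
    · subst hk; simp [Z, e, Matrix.vecMulVec_apply]
    · simp [Z, e, Matrix.vecMulVec_apply, hk]
  have hXZ' : (σ ^ 2)⁻¹ • X' = Z + Matrix.vecMulVec e ((σ ^ 2)⁻¹ • X' i) := by
    ext k j
    by_cases hk : k = i
    · subst hk; simp [Z, e, Matrix.vecMulVec_apply]
    · simp [Z, e, Matrix.vecMulVec_apply, hk, hi k hk j]
  have hnorm : frobInner X' X' - frobInner X X ≤ p := by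
    rw [frobInner_eq_sum, frobInner_eq_sum, ← Finset.sum_sub_distrib,
      Finset.sum_eq_single i (fun k _ hk => by simp [hi k hk]) (by simp)]
    have h1 : ∑ j, X' i j * X' i j ≤ (p : ℝ) := row_dotProduct_self_le_of_bounded hX' i
    have h2 : 0 ≤ ∑ j, X i j * X i j := Finset.sum_nonneg fun j _ => mul_self_nonneg _
    linarith
  have havg : orthExpAvg y ((σ ^ 2)⁻¹ • X) ≤
      ENNReal.ofReal (Real.exp (p * frobInner y y / (2 * ((n : ℝ) - p) * σ ^ 4))) *
        orthExpAvg y ((σ ^ 2)⁻¹ • X') := by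
    rw [hXZ, hXZ']
    refine (orthExpAvg_add_vecMulVec_le hpn y Z _ he heZ).trans ?_
    refine mul_le_mul' (ENNReal.ofReal_le_ofReal (Real.exp_le_exp.2 ?_))
      (orthExpAvg_le_add_vecMulVec y Z _ he heZ)
    have hrow := row_dotProduct_self_le_of_bounded hX i
    have hy := frobInner_self_nonneg y
    calc frobInner y y * ((σ ^ 2)⁻¹ • X i ⬝ᵥ (σ ^ 2)⁻¹ • X i) / (2 * ((n : ℝ) - p))
        = frobInner y y * (X i ⬝ᵥ X i) / (2 * ((n : ℝ) - p) * σ ^ 4) := by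
          rw [smul_dotProduct, dotProduct_smul, smul_eq_mul, smul_eq_mul]
          field_simp
      _ ≤ frobInner y y * p / (2 * ((n : ℝ) - p) * σ ^ 4) := by gcongr
      _ = _ := by rw [mul_comm (p : ℝ)]
  rw [releaseDensity_eq hσ, releaseDensity_eq hσ]
  refine (mul_le_mul_right havg _).trans ?_
  rw [← mul_assoc, ← mul_assoc, ← ENNReal.ofReal_mul (by positivity),
    ← ENNReal.ofReal_mul (by positivity)]
  refine mul_le_mul_left (ENNReal.ofReal_le_ofReal ?_) _
  rw [mul_assoc, mul_left_comm (Real.exp (_ + _)), ← Real.exp_add, ← Real.exp_add]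
  refine mul_le_mul_of_nonneg_left (Real.exp_le_exp.2 ?_) (by positivity)
  have h3 : (frobInner X' X' - frobInner X X) / (2 * σ ^ 2) ≤ p / (2 * σ ^ 2) := by gcongr
  have h4 : -(frobInner y y + frobInner X X) / (2 * σ ^ 2) =
      -(frobInner y y + frobInner X' X') / (2 * σ ^ 2) +
        (frobInner X' X' - frobInner X X) / (2 * σ ^ 2) := by ring
  linarith

/-! ### The density-set condition -/

lemma frobInner_add_self_le {n p : ℕ} (U V : DataMatrix n p) :
    frobInner (U + V) (U + V) ≤ 2 * frobInner U U + 2 * frobInner V V := by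
  simp only [frobInner_eq_sum, Finset.mul_sum, ← Finset.sum_add_distrib, Matrix.add_apply]
  refine Finset.sum_le_sum fun i _ => Finset.sum_le_sum fun j _ => ?_
  nlinarith [sq_nonneg (U i j - V i j)]

/-- A release is bounded through `‖A X + C‖² ≤ 2 ‖X‖² + 2 ‖C‖²`, where `‖X‖² ≤ n p`. -/
lemma settingC_tail {n p : ℕ} {σ : ℝ} (hσ : 0 < σ) {X : DataMatrix n p} (hX : Bounded X) (L : ℝ) :
    settingC n p σ X {y | 2 * ((n : ℝ) * p) + 2 * (σ ^ 2 * (2 * ((n : ℝ) * p) + 4 * L)) ≤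
      frobInner y y} ≤ ENNReal.ofReal (Real.exp (-L)) := by
  have hm := measurable_orth_mul_add X
  have hcont : Continuous fun y : DataMatrix n p => frobInner y y := by
    unfold frobInner
    fun_prop
  rw [settingC, Measure.map_apply hm (isClosed_le continuous_const hcont).measurableSet]
  refine le_trans (measure_mono (t := Set.univ ×ˢ
    {c | σ ^ 2 * (2 * ((n : ℝ) * p) + 4 * L) ≤ frobInner c c}) ?_) ?_
  · rintro ⟨A, c⟩ hw
    refine ⟨trivial, ?_⟩
    simp only [Set.mem_preimage, Set.mem_ofPred_eq] at hw ⊢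
    have h1 := frobInner_add_self_le ((A : Matrix (Fin n) (Fin n) ℝ) * X) c
    rw [frobInner_orth_mul] at h1
    linarith [frobInner_self_le_of_bounded hX]
  · rw [Measure.prod_prod, measure_univ, one_mul]
    exact gaussianNoise_tail n p hσ L

/-- Outside the tail event of `settingC_tail`, the logarithm of the density ratio is at most `ε`. -/
lemma densitySetCondition_settingC {n p : ℕ} (hp : 1 ≤ p) (hpn : p < n) {ε δ σ : ℝ} (hε : 0 < ε)
    (hε1 : ε < 1) (hδ : 0 < δ) (hδ1 : δ < 1) (hσ : 0 < σ)
    (h : 4 * (p : ℝ) * (2 * (n : ℝ) * p + 3 * Real.log (1 / δ)) ≤ σ ^ 2 * ε * ((n : ℝ) - p)) :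
    DensitySetCondition ε δ (settingC n p σ) := by
  refine ⟨fun X _ => ⟨?_, ?_⟩, fun X X' hX hX' hXX' => ?_⟩
  · exact Measure.isProbabilityMeasure_map (measurable_orth_mul_add X).aemeasurable
  · rw [settingC_eq_withDensity hσ]
    exact withDensity_absolutelyContinuous _ _
  obtain ⟨-, i, hi⟩ := hXX'
  set L := Real.log (1 / δ) with hL
  have hL0 : 0 ≤ L := Real.log_nonneg ((one_le_div hδ).2 hδ1.le)
  have hδL : δ = Real.exp (-L) := by
    rw [hL, one_div, Real.log_inv, neg_neg, Real.exp_log hδ]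
  have hp1 : (1 : ℝ) ≤ p := by exact_mod_cast hp
  have hn : (p : ℝ) < n := by exact_mod_cast hpn
  set k : ℝ := (n : ℝ) * p with hk
  have hnk : (n : ℝ) ≤ k := by rw [hk]; nlinarith
  -- The noise dominates the data, so that `‖X‖² ≤ n p` costs only a fraction of the bound.
  have hσ8 : 8 ≤ σ ^ 2 := by
    have h1 : 8 * (n : ℝ) ≤ σ ^ 2 * n := calc
      8 * (n : ℝ) ≤ 4 * p * (2 * n * p + 3 * L) := by nlinarith
      _ ≤ σ ^ 2 * ε * ((n : ℝ) - p) := h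
      _ ≤ σ ^ 2 * 1 * n := by
        have : (0 : ℝ) ≤ (n : ℝ) - p := by linarith
        gcongr
        linarith
      _ = σ ^ 2 * n := by ring
    exact le_of_mul_le_mul_right h1 (by linarith)
  rw [hδL]
  refine le_trans (measure_mono_ae ?_) (settingC_tail hσ hX L)
  rw [settingC_eq_withDensity hσ X, settingC_eq_withDensity hσ X']
  refine (withDensity_absolutelyContinuous _ _).ae_le ?_
  filter_upwards [Measure.rnDeriv_withDensity volume (measurable_releaseDensity σ X),
    Measure.rnDeriv_withDensity volume (measurable_releaseDensity σ X')] with y hy hy' hmem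
  change _ > _ at hmem
  rw [hy, hy'] at hmem
  by_contra hlt
  replace hlt : frobInner y y < 2 * k + 2 * (σ ^ 2 * (2 * k + 4 * L)) := not_le.1 hlt
  refine absurd hmem (not_lt.2 ((releaseDensity_le hpn hσ hX hX' hi y).trans ?_))
  refine mul_le_mul_left (ENNReal.ofReal_le_ofReal (Real.exp_le_exp.2 ?_)) _
  have hm : (0 : ℝ) < (n : ℝ) - p := by linarith
  have hq : frobInner y y + ((n : ℝ) - p) * σ ^ 2 ≤ 8 * σ ^ 2 * (2 * k + 3 * L) := by
    nlinarith [mul_nonneg (sq_nonneg σ) hL0]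
  have hfin : (p : ℝ) * (frobInner y y + ((n : ℝ) - p) * σ ^ 2) ≤
      ε * (2 * ((n : ℝ) - p) * σ ^ 4) := calc
    _ ≤ (p : ℝ) * (8 * σ ^ 2 * (2 * k + 3 * L)) := by gcongr
    _ = 2 * σ ^ 2 * (4 * p * (2 * n * p + 3 * L)) := by rw [hk]; ring
    _ ≤ 2 * σ ^ 2 * (σ ^ 2 * ε * ((n : ℝ) - p)) := by gcongr
    _ = _ := by ring
  calc (p : ℝ) * frobInner y y / (2 * ((n : ℝ) - p) * σ ^ 4) + p / (2 * σ ^ 2)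
      = (p : ℝ) * (frobInner y y + ((n : ℝ) - p) * σ ^ 2) / (2 * ((n : ℝ) - p) * σ ^ 4) := by
        field_simp
    _ ≤ ε := (div_le_iff₀ (by positivity)).2 hfin

end MatrixMasking

end

theorem mainTheorem2 (p : ℕ) (hp : 1 ≤ p) :
    (∀ n : ℕ, p < n → ∀ ε δ σ : ℝ, 0 < ε → ε < 1 → 0 < δ → δ < 1 →
      σ ≥ Real.sqrt ((2 * (n : ℝ) * (p : ℝ) + 3 * Real.log (1 / δ)) / ((n : ℝ) - (p : ℝ))) *
          (Real.sqrt (4 * (p : ℝ)) / Real.sqrt ε) →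
        MatrixMasking.DensitySetCondition ε δ (MatrixMasking.settingB n p σ) ∧
        MatrixMasking.DensitySetCondition ε δ (MatrixMasking.settingC n p σ)) ∧
    (∀ K : ℝ, 0 < K → ∃ M : ℝ, 0 < M ∧
      ∀ n : ℕ, p < n → ∀ ε δ σ : ℝ, 0 < ε → ε < 1 → 0 < δ → δ < 1 →
        Real.log (1 / δ) ≤ K * ((n : ℝ) / (p : ℝ)) → 0 < σ → σ ^ 2 ≥ M / ε →
          MatrixMasking.DensitySetCondition ε δ (MatrixMasking.settingB n p σ) ∧
          MatrixMasking.DensitySetCondition ε δ (MatrixMasking.settingC n p σ)) := by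
  have main : ∀ n : ℕ, p < n → ∀ ε δ σ : ℝ, 0 < ε → ε < 1 → 0 < δ → δ < 1 → 0 < σ →
      4 * (p : ℝ) * (2 * (n : ℝ) * p + 3 * Real.log (1 / δ)) ≤ σ ^ 2 * ε * ((n : ℝ) - p) →
        MatrixMasking.DensitySetCondition ε δ (MatrixMasking.settingB n p σ) ∧
        MatrixMasking.DensitySetCondition ε δ (MatrixMasking.settingC n p σ) := by
    intro n hpn ε δ σ hε hε1 hδ hδ1 hσ h
    have hC := MatrixMasking.densitySetCondition_settingC hp hpn hε hε1 hδ hδ1 hσ h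
    exact ⟨by rwa [MatrixMasking.settingB_eq_settingC hσ], hC⟩
  have hp0 : (0 : ℝ) < p := by exact_mod_cast hp
  refine ⟨fun n hpn ε δ σ hε hε1 hδ hδ1 hσ => ?_, fun K hK => ?_⟩
  · have hn : (p : ℝ) < n := by exact_mod_cast hpn
    have hm : (0 : ℝ) < (n : ℝ) - p := by linarith
    have hL : 0 ≤ Real.log (1 / δ) := Real.log_nonneg ((one_le_div hδ).2 hδ1.le)
    have hn0 : (0 : ℝ) < n := hp0.trans hn
    set S := 2 * (n : ℝ) * p + 3 * Real.log (1 / δ) with hS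
    have hS0 : 0 < S := by positivity
    have hσ0 : 0 < σ := lt_of_lt_of_le (by positivity) hσ
    refine main n hpn ε δ σ hε hε1 hδ hδ1 hσ0 ?_
    have hsq : S / ((n : ℝ) - p) * (4 * p / ε) ≤ σ ^ 2 := by
      have := pow_le_pow_left₀ (by positivity) hσ 2
      rwa [mul_pow, div_pow, Real.sq_sqrt (by positivity), Real.sq_sqrt (by positivity),
        Real.sq_sqrt hε.le] at this
    rw [div_mul_div_comm, div_le_iff₀ (by positivity)] at hsq
    linarith
  · -- `n / (n - p) ≤ p + 1` bounds the required noise variance uniformly in `n`.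
    refine ⟨(8 * (p : ℝ) ^ 2 + 12 * K) * (p + 1), by positivity,
      fun n hpn ε δ σ hε hε1 hδ hδ1 hδK hσ hσM => main n hpn ε δ σ hε hε1 hδ hδ1 hσ ?_⟩
    have hn : (p : ℝ) + 1 ≤ n := by exact_mod_cast hpn
    have hratio : (n : ℝ) ≤ (p + 1) * ((n : ℝ) - p) := by nlinarith
    have hpL : (p : ℝ) * Real.log (1 / δ) ≤ K * n := by
      calc (p : ℝ) * Real.log (1 / δ) ≤ p * (K * ((n : ℝ) / p)) := by gcongr
        _ = K * n := by field_simp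
    have hm : (0 : ℝ) ≤ (n : ℝ) - p := by linarith
    calc 4 * (p : ℝ) * (2 * (n : ℝ) * p + 3 * Real.log (1 / δ))
        ≤ (8 * (p : ℝ) ^ 2 + 12 * K) * n := by linarith
      _ ≤ (8 * (p : ℝ) ^ 2 + 12 * K) * ((p + 1) * ((n : ℝ) - p)) := by gcongr
      _ = (8 * (p : ℝ) ^ 2 + 12 * K) * (p + 1) * ((n : ℝ) - p) := by ring
      _ ≤ σ ^ 2 * ε * ((n : ℝ) - p) :=
        mul_le_mul_of_nonneg_right ((div_le_iff₀ hε).1 hσM) hm
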